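/- A \emph{one-way nondeterministic Turing machine} is a tuple $M=(Q,\Sigma,\Gamma,\delta,q_0,F)$ with finite state set $Q$, finite input alphabet $\Sigma$, finite worktape alphabet $\Gamma$ containing a blank symbol $\sqcup$, $q_0\in Q$, $F\subseteq Q$, and $\delta\subseteq Q\times(\Sigma\cup\{\lambda,\triangleleft\})\times\Gamma\times Q\times\Gamma\times\{\mathrm L,\mathrm S,\mathrm R\}$, where $\lambda$ is the empty word and $\triangleleft$ is the right end-marker of the input. A configuration is $(q,w,x\,h\,y)$ with $q\in Q$, remaining input $w\in\Sigma^*\triangleleft\cup\{\lambda\}$, and worktape contents $x\,h\,y$ with $x\in\Gamma^+$, $y\in\Gamma^*$, where $h$ is a new symbol marking the read/write head, which scans the last symbol of $x$. A transition $(q,a,c,q',d,D)\in\delta$ applies to $(q,aw,xc\,h\,y)$ (with $x,y\in\Gamma^*$, $c\in\Gamma$), and yields: * if $D=\mathrm S$: $(q',w,xd\,h\,y)$; * if $D=\mathrm L$: $(q',w,x'\,h\,d'y)$, where $x'=\sqcup$ if $x=\lambda$ and $x'=x$ otherwise, and $d'=\lambda$ if $y=\lambda$ and $d=\sqcup$,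 and $d'=d$ otherwise; * if $D=\mathrm R$: $(q',w,xd'c'\,h\,y')$, where $c'=\sqcup$, $y'=\lambda$ if $y=\lambda$ and $y=c'y'$ with $c'\in\Gamma$ otherwise, and $d'=\lambda$ if $x=\lambda$ and $d=\sqcup$, and $d'=d$ otherwise. A computation on $w\in\Sigma^*$ is a finite sequence of such steps (with the transitions used) starting in $(q_0,w\triangleleft,\sqcup h)$; it is accepting if its last configuration has a state in $F$ and remaining input $\lambda$. The \emph{store language} $S(M)$ is the set of all words $q\,x\,h\,y$, over the disjoint union $Q\cup\Gamma\cup\{h\}$, such that some configuration $(q,w',x\,h\,y)$ occurs in an accepting computation of $M$ on some $w\in\Sigma^*$. The addresses $i_0,\dots,i_n$ of the configurations of a computation are given by $i_0=1$ and $i_{j+1}=i_j-1,\ i_j,\ i_j+1$ according to whether the step from configuration $j$ to $j+1$ uses an $\mathrm L$, $\mathrm S$ or $\mathrm R$ transition. The computation is \emph{$k$-crossing} if for each $r\in\mathbb Z$ there are at most $k$ indices $0\le j<n$ with $\{i_j,i_{j+1}\}=\{r,r+1\}$; it is \emph{$k$-visit} if for each $r\in\mathbb Z$ there are at most $k$ indices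 $0\le j\le n$ with $i_j=r$; it is \emph{$k$-turn} if the direction of head movement changes (from left to right or from right to left, ignoring stay transitions) at most $k$ times. $M$ is \emph{finite-crossing} (resp. \emph{finite-visit}, \emph{finite-turn}) if there is a $k\ge 0$ such that every accepting computation of $M$ is $k$-crossing (resp. $k$-visit, $k$-turn). **Theorem.** Let $M$ be a one-way nondeterministic Turing machine. If $M$ is finite-crossing, then $S(M)$ is a regular language. Likewise, if $M$ is finite-visit, then $S(M)$ is regular, and if $M$ is finite-turn, then $S(M)$ is regular. -/

import Mathlib

/-- Symbols on the input tape: the letters of `A` and the right end-marker. -/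
inductive InputSym (A : Type*) where
  | letter (a : A)
  | endmark

/-- Worktape head directions: left, stay, right. -/
inductive Dir where
  | L
  | S
  | R

/-- Displacement of the worktape head. -/
def Dir.shift : Dir → ℤ
  | Dir.L => -1
  | Dir.S => 0
  | Dir.R => 1

/-- The alphabet of store words: states, worktape symbols and the head marker (disjointly). -/
inductive StoreSym (Q Γ : Type*) where
  | state (q : Q)
  | tape (c : Γ)
  | head

/-- A one-way nondeterministic Turing machine with state set `Q`, input alphabet `A` and worktape
alphabet `Γ`. A transition `(q, a, c, q', d, D)` in `δ` goes from state `q` to `q'`, reads `a`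
from the input (`none` is the empty word), replaces the scanned worktape symbol `c` by `d`
and moves the worktape head in direction `D`. -/
structure NTM (Q A Γ : Type*) where
  blank : Γ
  δ : Set (Q × Option (InputSym A) × Γ × Q × Γ × Dir)
  start : Q
  final : Set Q

namespace NTM

variable {Q A Γ : Type*}

/-- A configuration: state, remaining input, and the worktape `left ↿ right`, where the head
marker `↿` stands directly after the scanned symbol, so that the last symbol of `left` is the
scanned one. (In every configuration that takes or results from a step, `left` is non-empty.) -/
structure Config (Q A Γ : Type*) where
  state : Q
  input : List (InputSym A)
  left : List Γ
  right : List Γ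

/-- The store configuration (state followed by the worktape with head marker) as a word. -/
def Config.storeWord (c : Config Q A Γ) : List (StoreSym Q Γ) :=
  StoreSym.state c.state ::
    (c.left.map StoreSym.tape ++ StoreSym.head :: c.right.map StoreSym.tape)

open Classical in
/-- What remains of a cell holding `d` that the head leaves, when `z` is the tape beyond it
(on the side away from the head): a blank at the end of the tape is discarded. -/
noncomputable def leave (M : NTM Q A Γ) (d : Γ) (z : List Γ) : List Γ :=
  if z = [] ∧ d = M.blank then [] else [d]

/-- One step of the machine by a transition with the given head direction. -/
inductive Step (M : NTM Q A Γ) : Dir → Config Q A Γ → Config Q A Γ → Prop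
  | stay {q q' : Q} {a : Option (InputSym A)} {c d : Γ}
      (h : (q, a, c, q', d, Dir.S) ∈ M.δ) (w : List (InputSym A)) (x y : List Γ) :
      Step M Dir.S ⟨q, a.toList ++ w, x ++ [c], y⟩ ⟨q', w, x ++ [d], y⟩
  | leftEnd {q q' : Q} {a : Option (InputSym A)} {c d : Γ}
      (h : (q, a, c, q', d, Dir.L) ∈ M.δ) (w : List (InputSym A)) (y : List Γ) :
      Step M Dir.L ⟨q, a.toList ++ w, [c], y⟩ ⟨q', w, [M.blank], M.leave d y ++ y⟩
  | left {q q' : Q} {a : Option (InputSym A)} {c d : Γ}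
      (h : (q, a, c, q', d, Dir.L) ∈ M.δ) (w : List (InputSym A)) (x y : List Γ) (hx : x ≠ []) :
      Step M Dir.L ⟨q, a.toList ++ w, x ++ [c], y⟩ ⟨q', w, x, M.leave d y ++ y⟩
  | rightEnd {q q' : Q} {a : Option (InputSym A)} {c d : Γ}
      (h : (q, a, c, q', d, Dir.R) ∈ M.δ) (w : List (InputSym A)) (x : List Γ) :
      Step M Dir.R ⟨q, a.toList ++ w, x ++ [c], []⟩ ⟨q', w, x ++ M.leave d x ++ [M.blank], []⟩
  | right {q q' : Q} {a : Option (InputSym A)} {c d : Γ}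
      (h : (q, a, c, q', d, Dir.R) ∈ M.δ) (w : List (InputSym A)) (x : List Γ)
      (c' : Γ) (y' : List Γ) :
      Step M Dir.R ⟨q, a.toList ++ w, x ++ [c], c' :: y'⟩ ⟨q', w, x ++ M.leave d x ++ [c'], y'⟩

/-- The initial configuration on the input word `w`: the input is `w` followed by the end-marker,
the worktape is a single scanned blank. -/
def init (M : NTM Q A Γ) (w : List A) : Config Q A Γ :=
  ⟨M.start, w.map InputSym.letter ++ [InputSym.endmark], [M.blank], []⟩

/-- A configuration is accepting if its state is final and the whole input, including
the end-marker, has been read. -/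
def IsAccepting (M : NTM Q A Γ) (c : Config Q A Γ) : Prop :=
  c.state ∈ M.final ∧ c.input = []

/-- The derivation relation in zero or more steps. -/
def Derives (M : NTM Q A Γ) : Config Q A Γ → Config Q A Γ → Prop :=
  Relation.ReflTransGen fun c c' => ∃ D, M.Step D c c'

/-- The store language: all store configurations occurring in accepting computations. -/
def storeLanguage (M : NTM Q A Γ) : Language (StoreSym Q Γ) :=
  {s | ∃ (w : List A) (c c' : Config Q A Γ),
    M.Derives (M.init w) c ∧ M.Derives c c' ∧ M.IsAccepting c' ∧ s = c.storeWord}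

/-- An accepting computation: `len` steps from the configuration `cfg 0`, which is initial
on `word`, to the accepting configuration `cfg len`; step `j` uses a transition with direction
`dir j`. Values of `cfg` beyond `len` and of `dir` from `len` on are irrelevant. -/
structure AcceptingComputation (M : NTM Q A Γ) where
  word : List A
  len : ℕ
  cfg : ℕ → Config Q A Γ
  dir : ℕ → Dir
  cfg_zero : cfg 0 = M.init word
  step : ∀ j < len, M.Step (dir j) (cfg j) (cfg (j + 1))
  accepting : M.IsAccepting (cfg len)

namespace AcceptingComputation

variable {M : NTM Q A Γ}

/-- The worktape address of configuration `j`. -/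
def addr (C : M.AcceptingComputation) : ℕ → ℤ
  | 0 => 1
  | j + 1 => C.addr j + (C.dir j).shift

/-- The computation makes a turn on entering configuration `j + 1`: the head moves left in this
step and its latest earlier move was to the right, or vice versa. -/
def IsTurn (C : M.AcceptingComputation) (j : ℕ) : Prop :=
  (C.addr (j + 1) < C.addr j ∧
    ∃ l ≤ j, C.addr l < C.addr j ∧ ∀ m, l < m → m ≤ j → C.addr m = C.addr j) ∨
  (C.addr j < C.addr (j + 1) ∧
    ∃ l ≤ j, C.addr j < C.addr l ∧ ∀ m, l < m → m ≤ j → C.addr m = C.addr j)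

/-- At most `k` turns. -/
def IsTurnBounded (C : M.AcceptingComputation) (k : ℕ) : Prop :=
  {j : ℕ | j < C.len ∧ C.IsTurn j}.ncard ≤ k

/-- Every boundary between adjacent cells `r` and `r + 1` is crossed at most `k` times. -/
def IsCrossingBounded (C : M.AcceptingComputation) (k : ℕ) : Prop :=
  ∀ r : ℤ, {j : ℕ | j < C.len ∧ ((C.addr j = r ∧ C.addr (j + 1) = r + 1) ∨
    (C.addr j = r + 1 ∧ C.addr (j + 1) = r))}.ncard ≤ k

/-- Every cell is scanned in at most `k` configurations. -/
def IsVisitBounded (C : M.AcceptingComputation) (k : ℕ) : Prop :=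
  ∀ r : ℤ, {j : ℕ | j ≤ C.len ∧ C.addr j = r}.ncard ≤ k

end AcceptingComputation

/-- For some `k`, every accepting computation has at most `k` turns. -/
def FiniteTurn (M : NTM Q A Γ) : Prop :=
  ∃ k : ℕ, ∀ C : M.AcceptingComputation, C.IsTurnBounded k

/-- For some `k`, every accepting computation is `k`-visit. -/
def FiniteVisit (M : NTM Q A Γ) : Prop :=
  ∃ k : ℕ, ∀ C : M.AcceptingComputation, C.IsVisitBounded k

/-- For some `k`, every accepting computation is `k`-crossing. -/
def FiniteCrossing (M : NTM Q A Γ) : Prop :=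
  ∃ k : ℕ, ∀ C : M.AcceptingComputation, C.IsCrossingBounded k

end NTM

/-! The proof combines crossing sequences with the Myhill–Nerode criterion. Bounded visits and
bounded turns each bound crossings, so only the finite-crossing case needs an argument.

The input is eliminated first: it is read once and chosen existentially, so all that matters is
whether the end-marker has been read, and one bit in the control state records this. The worktape
becomes a two-way infinite tape. Since blank ends are discarded, the tape and the head position
determine the store word (`Represents.unique`).

Cut the tape at a boundary. A run splits into runs on the two halves that agree on the sequence of
control states at the crossings (`exists_half_runs`). Conversely, half runs with the same sequence
can be glued (`exists_zrun_of_half_runs`). For a configuration inside an accepting computation, each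
half thus matters only through its possible pairs of crossing sequences, before and after that
configuration, and through which half holds the head at the start. Sequences have length at most
`k`, so a half has one of finitely many behaviour sets `crossings`. Replacing the left half by
another with the same behaviour set preserves membership in the store language, apart from finite
data about blank ends. Hence there are finitely many left quotients (`isRegular_of_finite_index`).
-/

theorem Nat.ncard_setOf_lt_and (p : ℕ → Prop) [DecidablePred p] (n : ℕ) :
    {j : ℕ | j < n ∧ p j}.ncard = Nat.count p n := by
  rw [Nat.count_eq_card_filter_range, ← Set.ncard_coe_finset]
  congr 1
  ext j
  simp

/-! ### Bounded visits and bounded turns imply bounded crossings -/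

namespace NTM

variable {Q A Γ : Type*} {M : NTM Q A Γ}

namespace AcceptingComputation

/-- The step from configuration `j` to `j + 1` crosses the boundary between cells `r`, `r + 1`. -/
def Crosses (C : M.AcceptingComputation) (r : ℤ) (j : ℕ) : Prop :=
  (C.addr j = r ∧ C.addr (j + 1) = r + 1) ∨ (C.addr j = r + 1 ∧ C.addr (j + 1) = r)

/-- A step across the boundary departs from one of its two adjacent cells, and each is scanned at
most `k` times. -/
theorem IsVisitBounded.isCrossingBounded {C : M.AcceptingComputation} {k : ℕ}
    (h : C.IsVisitBounded k) : C.IsCrossingBounded (k + k) := by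
  intro r
  have hfin (s : ℤ) : {j : ℕ | j ≤ C.len ∧ C.addr j = s}.Finite :=
    (Set.finite_Iic C.len).subset fun j hj => hj.1
  refine (Set.ncard_le_ncard (t := {j : ℕ | j ≤ C.len ∧ C.addr j = r} ∪
    {j : ℕ | j ≤ C.len ∧ C.addr j = r + 1}) ?_ ((hfin _).union (hfin _))).trans
    ((Set.ncard_union_le _ _).trans (add_le_add (h r) (h (r + 1))))
  rintro j ⟨hj, h | h⟩
  · exact Or.inl ⟨hj.le, h.1⟩
  · exact Or.inr ⟨hj.le, h.1⟩

/-- The latest move before configuration `n` was to the right. -/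
def LastRight (C : M.AcceptingComputation) (n : ℕ) : Prop :=
  ∃ l ≤ n, C.addr l < C.addr n ∧ ∀ m, l < m → m ≤ n → C.addr m = C.addr n

/-- The latest move before configuration `n` was to the left. -/
def LastLeft (C : M.AcceptingComputation) (n : ℕ) : Prop :=
  ∃ l ≤ n, C.addr n < C.addr l ∧ ∀ m, l < m → m ≤ n → C.addr m = C.addr n

variable (C : M.AcceptingComputation) {n : ℕ}

theorem lastRight_succ :
    C.LastRight (n + 1) ↔ C.addr n < C.addr (n + 1) ∨
      (C.addr (n + 1) = C.addr n ∧ C.LastRight n) := by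
  constructor
  · rintro ⟨l, hl, hlt, hm⟩
    rcases Nat.lt_or_ge l n with h | h
    · have h1 := hm n h (by omega)
      refine Or.inr ⟨h1.symm, l, h.le, by omega, fun m h2 h3 => ?_⟩
      rw [hm m h2 (by omega), h1]
    · obtain rfl | rfl : l = n ∨ l = n + 1 := by omega
      · exact Or.inl hlt
      · omega
  · rintro (h | ⟨h, l, hl, hlt, hm⟩)
    · exact ⟨n, by omega, h, fun m h1 h2 => by rw [show m = n + 1 by omega]⟩
    · refine ⟨l, by omega, by omega, fun m h1 h2 => ?_⟩
      rcases Nat.lt_or_ge m (n + 1) with h3 | h3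
      · rw [hm m h1 (by omega), h]
      · rw [show m = n + 1 by omega]

theorem lastLeft_succ :
    C.LastLeft (n + 1) ↔ C.addr (n + 1) < C.addr n ∨
      (C.addr (n + 1) = C.addr n ∧ C.LastLeft n) := by
  constructor
  · rintro ⟨l, hl, hlt, hm⟩
    rcases Nat.lt_or_ge l n with h | h
    · have h1 := hm n h (by omega)
      refine Or.inr ⟨h1.symm, l, h.le, by omega, fun m h2 h3 => ?_⟩
      rw [hm m h2 (by omega), h1]
    · obtain rfl | rfl : l = n ∨ l = n + 1 := by omega
      · exact Or.inl hlt
      · omega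
  · rintro (h | ⟨h, l, hl, hlt, hm⟩)
    · exact ⟨n, by omega, h, fun m h1 h2 => by rw [show m = n + 1 by omega]⟩
    · refine ⟨l, by omega, by omega, fun m h1 h2 => ?_⟩
      rcases Nat.lt_or_ge m (n + 1) with h3 | h3
      · rw [hm m h1 (by omega), h]
      · rw [show m = n + 1 by omega]

theorem addr_succ_cases (n : ℕ) :
    C.addr (n + 1) = C.addr n - 1 ∨ C.addr (n + 1) = C.addr n ∨
      C.addr (n + 1) = C.addr n + 1 := by
  rw [show C.addr (n + 1) = C.addr n + (C.dir n).shift from rfl]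
  cases C.dir n <;> simp [Dir.shift]; omega

-- Successive crossings of one boundary have opposite directions, so a turn lies between them. The
-- second and third clauses strengthen the induction: if the head has already turned back towards
-- the boundary, the turn for the next crossing is already counted. The last clause covers the time
-- before the first move.
open Classical in
theorem count_crosses_le (r : ℤ) (n : ℕ) :
    Nat.count (C.Crosses r) n ≤ Nat.count C.IsTurn n + 1 ∧
    (r < C.addr n → C.LastLeft n → Nat.count (C.Crosses r) n ≤ Nat.count C.IsTurn n) ∧
    (C.addr n ≤ r → C.LastRight n → Nat.count (C.Crosses r) n ≤ Nat.count C.IsTurn n) ∧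
    (C.LastLeft n ∨ C.LastRight n ∨ Nat.count (C.Crosses r) n = 0) := by
  induction n with
  | zero =>
    simp
  | succ n ih =>
    obtain ⟨h1, h2, h3, h4⟩ := ih
    rw [Nat.count_succ, Nat.count_succ, lastLeft_succ, lastRight_succ]
    have hturn : C.IsTurn n ↔ (C.addr (n + 1) < C.addr n ∧ C.LastRight n) ∨
      (C.addr n < C.addr (n + 1) ∧ C.LastLeft n) := Iff.rfl
    have hcross : C.Crosses r n ↔ (C.addr n = r ∧ C.addr (n + 1) = r + 1) ∨
      (C.addr n = r + 1 ∧ C.addr (n + 1) = r) := Iff.rfl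
    rw [hturn, hcross]
    rcases C.addr_succ_cases n with h | h | h <;>
    by_cases hl : C.LastLeft n <;> by_cases hr : C.LastRight n <;>
    by_cases hc1 : C.addr n = r <;> by_cases hc2 : C.addr n = r + 1 <;>
    simp only [h, hl, hr, hc1, hc2] at * <;> grind

theorem IsTurnBounded.isCrossingBounded {C : M.AcceptingComputation} {k : ℕ}
    (h : C.IsTurnBounded k) : C.IsCrossingBounded (k + 1) := by
  classical
  intro r
  have h1 := (C.count_crosses_le r C.len).1
  rw [← Nat.ncard_setOf_lt_and, ← Nat.ncard_setOf_lt_and] at h1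
  exact h1.trans (Nat.succ_le_succ h)

end AcceptingComputation

theorem FiniteVisit.finiteCrossing (h : M.FiniteVisit) : M.FiniteCrossing :=
  h.imp' (fun k => k + k) fun _ hk C => (hk C).isCrossingBounded

theorem FiniteTurn.finiteCrossing (h : M.FiniteTurn) : M.FiniteCrossing :=
  h.imp' (fun k => k + 1) fun _ hk C => (hk C).isCrossingBounded

end NTM

/-! ### Store words and a Myhill–Nerode criterion -/

theorem Set.finite_range_of_factors {α β τ : Type*} [Finite τ] (φ : α → τ) {f : α → β}
    (h : ∀ a b, φ a = φ b → f a = f b) : (Set.range f).Finite := by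
  rcases isEmpty_or_nonempty β with hβ | hβ
  · exact Set.toFinite _
  · have hf : Function.FactorsThrough f φ := fun a b => h a b
    refine (Set.finite_range (Function.extend φ f fun _ => Classical.arbitrary β)).subset ?_
    rintro _ ⟨a, rfl⟩
    exact ⟨φ a, hf.extend_apply _ a⟩

section StoreWords

variable {Q Γ : Type*}

/-- The word of a state and a worktape with head marker. -/
def storeWord (q : Q) (x y : List Γ) : List (StoreSym Q Γ) :=
  StoreSym.state q :: (x.map StoreSym.tape ++ StoreSym.head :: y.map StoreSym.tape)

/-- The prefix of a store word that ends before the head marker. -/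
def storePrefix (q : Q) (x : List Γ) : List (StoreSym Q Γ) :=
  StoreSym.state q :: x.map StoreSym.tape

theorem map_tape_injective :
    Function.Injective (List.map (StoreSym.tape : Γ → StoreSym Q Γ)) :=
  List.map_injective_iff.2 fun a b h => by cases h; rfl

theorem head_cons_append_eq {u v : List (StoreSym Q Γ)} {y : List Γ}
    (h : u ++ v = StoreSym.head :: y.map StoreSym.tape) :
    u = [] ∨ ∃ y₁ y₂, u = StoreSym.head :: y₁.map StoreSym.tape ∧ v = y₂.map StoreSym.tape ∧
      y = y₁ ++ y₂ := by
  cases u with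
  | nil => exact Or.inl rfl
  | cons a u =>
    simp only [List.cons_append, List.cons.injEq] at h
    obtain ⟨rfl, h⟩ := h
    obtain ⟨y₁, y₂, rfl, rfl, rfl⟩ := List.append_eq_map_iff.1 h
    exact Or.inr ⟨y₁, y₂, rfl, rfl, rfl⟩

/-- The three shapes of a prefix are the cases in the count of left quotients. -/
theorem append_eq_storeWord {u v : List (StoreSym Q Γ)} {q : Q} {x y : List Γ}
    (h : u ++ v = storeWord q x y) :
    u = [] ∨
    (∃ x₁ x₂, u = storePrefix q x₁ ∧
      v = x₂.map StoreSym.tape ++ StoreSym.head :: y.map StoreSym.tape ∧ x = x₁ ++ x₂) ∨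
    ∃ y₁ y₂, u = storeWord q x y₁ ∧ v = y₂.map StoreSym.tape ∧ y = y₁ ++ y₂ := by
  cases u with
  | nil => exact Or.inl rfl
  | cons a u =>
    right
    simp only [List.cons_append, storeWord, List.cons.injEq] at h
    obtain ⟨rfl, h⟩ := h
    rcases List.append_eq_append_iff.1 h with ⟨w, hw, rfl⟩ | ⟨w, rfl, hw⟩
    · obtain ⟨x₁, x₂, rfl, rfl, rfl⟩ := List.map_eq_append_iff.1 hw
      exact Or.inl ⟨_, _, rfl, rfl, rfl⟩
    · rcases head_cons_append_eq hw.symm with rfl | ⟨y₁, y₂, rfl, rfl, rfl⟩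
      · exact Or.inl ⟨x, [], by simp [storePrefix], by simpa using hw.symm, by simp⟩
      · exact Or.inr ⟨y₁, y₂, rfl, rfl, rfl⟩

theorem storeWord_injective {q q' : Q} {x y x' y' : List Γ}
    (h : storeWord q x y = storeWord q' x' y') : q = q' ∧ x = x' ∧ y = y' := by
  rcases append_eq_storeWord (u := storePrefix q x) (by simpa [storePrefix, storeWord] using h)
    with h1 | ⟨x₁, x₂, h1, h2, h3⟩ | ⟨y₁, y₂, h1, h2, h3⟩
  · simp [storePrefix] at h1
  · simp only [storePrefix, List.cons.injEq, StoreSym.state.injEq] at h1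
    obtain rfl := map_tape_injective h1.2
    cases x₂ with
    | nil => exact ⟨h1.1, by simpa using h3.symm, map_tape_injective (by simpa using h2)⟩
    | cons c x₂ => simp at h2
  · have := congrArg (StoreSym.head ∈ ·) h1
    simp [storePrefix, storeWord] at this

/-- A set of store words is regular if the tape prefixes, of the part before and of the part
after the head marker, fall into finitely many classes of words with the same continuations. -/
theorem isRegular_of_finite_index [Finite Q] {L : Language (StoreSym Q Γ)}
    {G : Q → List Γ → List Γ → Prop} (hL : ∀ s, s ∈ L ↔ ∃ q x y, s = storeWord q x y ∧ G q x y)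
    {τ τ' : Type*} [Finite τ] [Finite τ'] (φ : List Γ → τ) (ψ : Q → List Γ → List Γ → τ')
    (hφ : ∀ q x₁ x₂, φ x₁ = φ x₂ → ∀ x y, x ≠ [] → G q (x₁ ++ x) y → G q (x₂ ++ x) y)
    (hψ : ∀ q x₁ x₂ y₁ y₂, ψ q x₁ y₁ = ψ q x₂ y₂ → ∀ y, G q x₁ (y₁ ++ y) → G q x₂ (y₂ ++ y)) :
    L.IsRegular := by
  have hpre (q : Q) (x₁ x₂ : List Γ) (h1 : φ x₁ = φ x₂) (h2 : ψ q x₁ [] = ψ q x₂ []) :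
      L.leftQuotient (storePrefix q x₁) ≤ L.leftQuotient (storePrefix q x₂) := by
    intro v hv
    obtain ⟨q', x, y, he, hG⟩ := (hL _).1 hv
    refine (hL _).2 ?_
    rcases append_eq_storeWord he with h | ⟨w, w', h3, rfl, rfl⟩ | ⟨w, w', h3, -, -⟩
    · simp [storePrefix] at h
    · simp only [storePrefix, List.cons.injEq, StoreSym.state.injEq] at h3
      obtain ⟨rfl, h3⟩ := h3
      obtain rfl := map_tape_injective h3
      refine ⟨q, x₂ ++ w', y, by simp [storePrefix, storeWord], ?_⟩
      -- If the head marker follows immediately, the scanned cell belongs to the prefix. `φ`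
      -- describes only prefixes that do not contain the head, so this case uses `ψ` with empty
      -- right part.
      rcases eq_or_ne w' [] with rfl | hw
      · simpa using hψ q x₁ x₂ [] [] h2 y (by simpa using hG)
      · exact hφ q x₁ x₂ h1 w' y hw hG
    · have := congrArg (StoreSym.head ∈ ·) h3
      simp [storePrefix, storeWord] at this
  have hpost (q : Q) (x₁ x₂ y₁ y₂ : List Γ) (h : ψ q x₁ y₁ = ψ q x₂ y₂) :
      L.leftQuotient (storeWord q x₁ y₁) ≤ L.leftQuotient (storeWord q x₂ y₂) := by
    intro v hv
    obtain ⟨q', x, y, he, hG⟩ := (hL _).1 hv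
    refine (hL _).2 ?_
    rcases append_eq_storeWord he with h | ⟨w, w', h3, -, -⟩ | ⟨w, w', h3, rfl, rfl⟩
    · simp [storeWord] at h
    · have := congrArg (StoreSym.head ∈ ·) h3
      simp [storePrefix, storeWord] at this
    · obtain ⟨rfl, rfl, rfl⟩ := storeWord_injective h3
      exact ⟨q, x₂, y₂ ++ w', by simp [storeWord], hψ q x₁ x₂ y₁ y₂ h w' hG⟩
  apply Language.IsRegular.of_finite_range_leftQuotient
  have hfin1 : (Set.range fun p : Q × List Γ => L.leftQuotient (storePrefix p.1 p.2)).Finite := by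
    refine Set.finite_range_of_factors (fun p => (p.1, φ p.2, ψ p.1 p.2 [])) ?_
    rintro ⟨q, x⟩ ⟨q', x'⟩ h
    simp only [Prod.mk.injEq] at h
    obtain ⟨rfl, h1, h2⟩ := h
    exact le_antisymm (hpre _ _ _ h1 h2) (hpre _ _ _ h1.symm h2.symm)
  have hfin2 : (Set.range fun p : Q × List Γ × List Γ =>
      L.leftQuotient (storeWord p.1 p.2.1 p.2.2)).Finite := by
    refine Set.finite_range_of_factors (fun p => (p.1, ψ p.1 p.2.1 p.2.2)) ?_
    rintro ⟨q, x, y⟩ ⟨q', x', y'⟩ h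
    simp only [Prod.mk.injEq] at h
    obtain ⟨rfl, h1⟩ := h
    exact le_antisymm (hpost _ _ _ _ _ h1) (hpost _ _ _ _ _ h1.symm)
  -- `L` is the quotient by the empty word, `⊥` the quotient by a word with no continuation in `L`.
  refine ((hfin1.union hfin2).union (Set.toFinite {L, ⊥})).subset ?_
  rintro _ ⟨u, rfl⟩
  by_cases hu : ∃ v, u ++ v ∈ L
  · obtain ⟨v, hv⟩ := hu
    obtain ⟨q, x, y, he, -⟩ := (hL _).1 hv
    rcases append_eq_storeWord he with rfl | ⟨w, _, rfl, -⟩ | ⟨w, _, rfl, -⟩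
    · exact Or.inr (Or.inl rfl)
    · exact Or.inl (Or.inl ⟨(q, w), rfl⟩)
    · exact Or.inl (Or.inr ⟨(q, x, w), rfl⟩)
  · refine Or.inr (Or.inr (eq_bot_iff.2 fun v hv => hu ⟨v, hv⟩))

end StoreWords

/-! ### Cutting a run at a boundary and gluing half runs -/

section HalfTapes

variable {P Γ : Type*}

/-- A configuration of an input-free machine on a two-way infinite tape. -/
structure ZConf (P Γ : Type*) where
  ctl : P
  tape : ℤ → Γ
  pos : ℤ

/-- A step with the transition relation `R` on the two-way infinite tape. -/
inductive ZStep (R : P → Γ → P → Γ → Dir → Prop) : Dir → ZConf P Γ → ZConf P Γ → Prop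
  | mk {p p' : P} {T : ℤ → Γ} {i : ℤ} {d : Γ} {D : Dir} (h : R p (T i) p' d D) :
      ZStep R D ⟨p, T, i⟩ ⟨p', Function.update T i d, i + D.shift⟩

/-- Finite sequences of steps on the two-way infinite tape. -/
def ZRun (R : P → Γ → P → Γ → Dir → Prop) : ZConf P Γ → ZConf P Γ → Prop :=
  Relation.ReflTransGen fun z z' => ∃ D, ZStep R D z z'

/-- A half-infinite tape, numbered from its boundary, with the control state and the position
of the head if the head is on this half. -/
@[ext]
structure Half (P Γ : Type*) where
  act : Option (P × ℕ)
  tape : ℕ → Γ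

/-- A step on a half tape, which extends to the right if `e = 1` and to the left if `e = -1`.
Steps on which the head leaves or enters are labelled with the new control state. -/
inductive HStep (R : P → Γ → P → Γ → Dir → Prop) (e : ℤ) :
    Option P → Half P Γ → Half P Γ → Prop
  | inner {p p' : P} {T : ℕ → Γ} {n m : ℕ} {d : Γ} {D : Dir} (h : R p (T n) p' d D)
      (hm : (m : ℤ) = n + e * D.shift) :
      HStep R e none ⟨some (p, n), T⟩ ⟨some (p', m), Function.update T n d⟩
  | exit {p p' : P} {T : ℕ → Γ} {d : Γ} {D : Dir} (h : R p (T 0) p' d D)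
      (hD : e * D.shift = -1) :
      HStep R e (some p') ⟨some (p, 0), T⟩ ⟨none, Function.update T 0 d⟩
  | enter (p : P) (T : ℕ → Γ) : HStep R e (some p) ⟨none, T⟩ ⟨some (p, 0), T⟩

/-- A run on a half tape, with the sequence of its labels. -/
inductive HRun (R : P → Γ → P → Γ → Dir → Prop) (e : ℤ) :
    List P → Half P Γ → Half P Γ → Prop
  | refl (a : Half P Γ) : HRun R e [] a a
  | inner {a b c : Half P Γ} {s : List P} (h : HStep R e none a b) (hr : HRun R e s b c) :
      HRun R e s a c
  | sync {a b c : Half P Γ} {p : P} {s : List P} (h : HStep R e (some p) a b)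
      (hr : HRun R e s b c) : HRun R e (p :: s) a c

/-- The half of a tape that starts at cell `b` and extends in direction `e`. -/
def ZConf.half (e b : ℤ) (z : ZConf P Γ) : Half P Γ where
  act := if 0 ≤ e * (z.pos - b) then some (z.ctl, (e * (z.pos - b)).toNat) else none
  tape n := z.tape (b + e * n)

variable {R : P → Γ → P → Γ → Dir → Prop} {e : ℤ}

theorem HRun.trans {s t : List P} {a b c : Half P Γ} (h : HRun R e s a b) (h' : HRun R e t b c) :
    HRun R e (s ++ t) a c := by
  induction h with
  | refl => exact h'
  | inner h _ ih => exact .inner h (ih h')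
  | sync h _ ih => exact .sync h (ih h')

theorem ZConf.half_act_of_nonneg {b : ℤ} {z : ZConf P Γ} {n : ℕ} (h : e * (z.pos - b) = n) :
    (z.half e b).act = some (z.ctl, n) := by
  simp [ZConf.half, h]

theorem ZConf.half_act_of_neg {b : ℤ} {z : ZConf P Γ} (h : e * (z.pos - b) < 0) :
    (z.half e b).act = none := by
  simp [ZConf.half, h]

theorem half_tape_update (he : e = 1 ∨ e = -1) {b i : ℤ} {n : ℕ} (T : ℤ → Γ) (d : Γ)
    (h : e * (i - b) = n) :
    (fun m : ℕ => Function.update T i d (b + e * m)) =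
      Function.update (fun m : ℕ => T (b + e * m)) n d := by
  funext m
  simp only [Function.update_apply]
  congr 1
  rw [eq_iff_iff]
  rcases he with rfl | rfl <;> omega

theorem half_tape_update_of_neg (he : e = 1 ∨ e = -1) {b i : ℤ} (T : ℤ → Γ) (d : Γ)
    (h : e * (i - b) < 0) :
    (fun m : ℕ => Function.update T i d (b + e * m)) = fun m : ℕ => T (b + e * m) := by
  funext m
  rw [Function.update_of_ne]
  rcases he with rfl | rfl <;> omega

theorem Dir.shift_cases (D : Dir) : D.shift = -1 ∨ D.shift = 0 ∨ D.shift = 1 := by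
  cases D <;> simp [Dir.shift]

/-- The label of a crossing is the control state after the step, so the half being left and the half
being entered carry the same label. The equality alternative is a step made entirely outside this
half. -/
theorem ZStep.half_hstep (he : e = 1 ∨ e = -1) (b : ℤ) {D : Dir} {z z' : ZConf P Γ}
    (h : ZStep R D z z') :
    ((0 ≤ e * (z.pos - b) ↔ 0 ≤ e * (z'.pos - b)) →
      HStep R e none (z.half e b) (z'.half e b) ∨ z.half e b = z'.half e b) ∧
    (¬(0 ≤ e * (z.pos - b) ↔ 0 ≤ e * (z'.pos - b)) →
      HStep R e (some z'.ctl) (z.half e b) (z'.half e b)) := by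
  obtain @⟨p, p', T, i, d, D, h⟩ := h
  have hD := D.shift_cases
  dsimp only
  by_cases h1 : 0 ≤ e * (i - b)
  · obtain ⟨n, hn⟩ := Int.eq_ofNat_of_zero_le h1
    have hT := half_tape_update he T d hn
    have hc : T i = T (b + e * n) := by
      congr 1; rcases he with rfl | rfl <;> omega
    rw [hc] at h
    have e1 : (⟨p, T, i⟩ : ZConf P Γ).half e b = ⟨some (p, n), fun m : ℕ => T (b + e * m)⟩ :=
      Half.ext (ZConf.half_act_of_nonneg hn) rfl
    by_cases h2 : 0 ≤ e * (i + D.shift - b)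
    · obtain ⟨m, hm⟩ := Int.eq_ofNat_of_zero_le h2
      have e2 : (⟨p', Function.update T i d, i + D.shift⟩ : ZConf P Γ).half e b =
          ⟨some (p', m), Function.update (fun m : ℕ => T (b + e * m)) n d⟩ :=
        Half.ext (ZConf.half_act_of_nonneg hm) hT
      refine ⟨fun _ => Or.inl ?_, fun hh => absurd (iff_of_true h1 h2) hh⟩
      rw [e1, e2]
      exact .inner h (by linarith)
    · have e2 : (⟨p', Function.update T i d, i + D.shift⟩ : ZConf P Γ).half e b =
          ⟨none, Function.update (fun m : ℕ => T (b + e * m)) n d⟩ :=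
        Half.ext (ZConf.half_act_of_neg (not_le.1 h2)) hT
      refine ⟨fun hh => absurd (hh.1 h1) h2, fun _ => ?_⟩
      obtain rfl : n = 0 := by rcases he with rfl | rfl <;> omega
      rw [e1, e2]
      exact .exit h (by rcases he with rfl | rfl <;> omega)
  · have hT := half_tape_update_of_neg he T d (not_le.1 h1)
    have e1 : (⟨p, T, i⟩ : ZConf P Γ).half e b = ⟨none, fun m : ℕ => T (b + e * m)⟩ :=
      Half.ext (ZConf.half_act_of_neg (not_le.1 h1)) rfl
    by_cases h2 : 0 ≤ e * (i + D.shift - b)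
    · have e2 : (⟨p', Function.update T i d, i + D.shift⟩ : ZConf P Γ).half e b =
          ⟨some (p', 0), fun m : ℕ => T (b + e * m)⟩ :=
        Half.ext (ZConf.half_act_of_nonneg
          (by dsimp only; rcases he with rfl | rfl <;> omega)) hT
      refine ⟨fun hh => absurd (hh.2 h2) h1, fun _ => ?_⟩
      rw [e1, e2]
      exact .enter _ _
    · have e2 : (⟨p', Function.update T i d, i + D.shift⟩ : ZConf P Γ).half e b =
          ⟨none, fun m : ℕ => T (b + e * m)⟩ :=
        Half.ext (ZConf.half_act_of_neg (not_le.1 h2)) hT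
      refine ⟨fun _ => Or.inr ?_, fun hh => absurd (iff_of_false h1 h2) hh⟩
      rw [e1, e2]

open Classical in
/-- A run of the whole machine induces runs on the two halves of the tape that have the same
labels, one for each crossing of the boundary between cells `r` and `r + 1`. -/
theorem exists_half_runs {z : ℕ → ZConf P Γ} {dir : ℕ → Dir} {n : ℕ}
    (hz : ∀ j < n, ZStep R (dir j) (z j) (z (j + 1))) (r : ℤ) {a b : ℕ} (hab : a ≤ b)
    (hb : b ≤ n) :
    ∃ s : List P, s.length ≤ Nat.count (fun j => ((z j).pos = r ∧ (z (j + 1)).pos = r + 1) ∨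
        ((z j).pos = r + 1 ∧ (z (j + 1)).pos = r)) b ∧
      HRun R (-1) s ((z a).half (-1) r) ((z b).half (-1) r) ∧
      HRun R 1 s ((z a).half 1 (r + 1)) ((z b).half 1 (r + 1)) := by
  induction b, hab using Nat.le_induction with
  | base => exact ⟨[], Nat.zero_le _, .refl _, .refl _⟩
  | succ b hab ih =>
    obtain ⟨s, hs, h1, h2⟩ := ih (by omega)
    have hl := (hz b hb).half_hstep (e := -1) (Or.inr rfl) r
    have hr := (hz b hb).half_hstep (e := 1) (Or.inl rfl) (r + 1)
    have hz' := hz b hb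
    have hpos : (z (b + 1)).pos = (z b).pos + (dir b).shift := by
      generalize z b = x, z (b + 1) = y, dir b = D at hz'
      cases hz'
      rfl
    have hD := (dir b).shift_cases
    by_cases hc : (0 ≤ -1 * ((z b).pos - r) ↔ 0 ≤ -1 * ((z (b + 1)).pos - r))
    · have hc' : (0 ≤ 1 * ((z b).pos - (r + 1)) ↔ 0 ≤ 1 * ((z (b + 1)).pos - (r + 1))) := by
        omega
      refine ⟨s, hs.trans (Nat.count_monotone _ (Nat.le_succ b)), ?_, ?_⟩
      · rcases hl.1 hc with h | h
        · simpa using h1.trans (.inner h (.refl _))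
        · rwa [← h]
      · rcases hr.1 hc' with h | h
        · simpa using h2.trans (.inner h (.refl _))
        · rwa [← h]
    · have hc' : ¬(0 ≤ 1 * ((z b).pos - (r + 1)) ↔ 0 ≤ 1 * ((z (b + 1)).pos - (r + 1))) := by
        omega
      refine ⟨s ++ [(z (b + 1)).ctl], ?_, h1.trans (.sync (hl.2 hc) (.refl _)),
        h2.trans (.sync (hr.2 hc') (.refl _))⟩
      rw [Nat.count_succ, if_pos (by omega)]
      simpa using hs

/-- The complement of the half `(e, b)` is `(-e, b - e)`. An inner step writes and moves only within
its own half, so the complement is unchanged. -/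
theorem HStep.exists_zstep_inner (he : e = 1 ∨ e = -1) {b : ℤ} {z : ZConf P Γ} {a : Half P Γ}
    (h : HStep R e none (z.half e b) a) :
    ∃ z' D, ZStep R D z z' ∧ z'.half e b = a ∧ z'.half (-e) (b - e) = z.half (-e) (b - e) := by
  obtain ⟨q, T, i⟩ := z
  generalize hz : (⟨q, T, i⟩ : ZConf P Γ).half e b = x at h
  cases h with
  | @inner p p' T' n m d D h hm =>
    by_cases h1 : 0 ≤ e * (i - b)
    · obtain ⟨k, hk⟩ := Int.eq_ofNat_of_zero_le h1
      have hact := ZConf.half_act_of_nonneg (z := ⟨q, T, i⟩) hk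
      rw [hz] at hact
      simp only [Option.some.injEq, Prod.mk.injEq] at hact
      obtain ⟨rfl, rfl⟩ := hact
      obtain rfl : (fun m : ℕ => T (b + e * m)) = T' := congrArg Half.tape hz
      have hc : T i = T (b + e * n) := by
        congr 1; rcases he with rfl | rfl <;> omega
      replace h : R p (T i) p' d D := hc ▸ h
      refine ⟨_, D, .mk h, ?_, ?_⟩
      · exact Half.ext (ZConf.half_act_of_nonneg (by dsimp only; linarith))
          (half_tape_update he T d hk)
      · refine Half.ext ?_ (half_tape_update_of_neg (by omega) T d
          (by rcases he with rfl | rfl <;> omega))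
        rw [ZConf.half_act_of_neg, ZConf.half_act_of_neg] <;> dsimp only <;>
          rcases he with rfl | rfl <;> omega
    · have hact := ZConf.half_act_of_neg (z := ⟨q, T, i⟩) (not_le.1 h1)
      rw [hz] at hact
      simp at hact

/-- The exiting half supplies the transition. The entering half accepts any control state, and the
common label makes it the right one. -/
theorem HStep.exists_zstep_exit (he : e = 1 ∨ e = -1) {b : ℤ} {z : ZConf P Γ} {a c : Half P Γ}
    {p : P} (h : HStep R e (some p) (z.half e b) a)
    (h' : HStep R (-e) (some p) (z.half (-e) (b - e)) c) (hin : 0 ≤ e * (z.pos - b)) :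
    ∃ z' D, ZStep R D z z' ∧ z'.half e b = a ∧ z'.half (-e) (b - e) = c := by
  obtain ⟨q, T, i⟩ := z
  dsimp only at hin
  obtain ⟨k, hk⟩ := Int.eq_ofNat_of_zero_le hin
  generalize hz : (⟨q, T, i⟩ : ZConf P Γ).half e b = x at h
  generalize hz' : (⟨q, T, i⟩ : ZConf P Γ).half (-e) (b - e) = y at h'
  have hact := ZConf.half_act_of_nonneg (z := ⟨q, T, i⟩) hk
  have hneg : -e * (i - (b - e)) < 0 := by rcases he with rfl | rfl <;> omega
  have hact' := ZConf.half_act_of_neg (z := ⟨q, T, i⟩) hneg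
  rw [hz] at hact
  rw [hz'] at hact'
  cases h with
  | enter => simp at hact
  | @exit p₀ _ T' d D h hD =>
    simp only [Option.some.injEq, Prod.mk.injEq] at hact
    obtain ⟨rfl, rfl⟩ := hact
    obtain rfl : (fun m : ℕ => T (b + e * m)) = T' := congrArg Half.tape hz
    have hc : T i = T (b + e * (0 : ℕ)) := by
      congr 1; rcases he with rfl | rfl <;> omega
    replace h : R p₀ (T i) p d D := hc ▸ h
    cases h' with
    | exit => simp at hact'
    | enter _ T₁ =>
      obtain rfl : (fun m : ℕ => T (b - e + -e * m)) = T₁ := congrArg Half.tape hz'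
      refine ⟨_, D, .mk h, ?_, ?_⟩
      · exact Half.ext (ZConf.half_act_of_neg (by dsimp only; rcases he with rfl | rfl <;> omega))
          (half_tape_update he T d hk)
      · exact Half.ext (ZConf.half_act_of_nonneg
          (by dsimp only; rcases he with rfl | rfl <;> omega))
          (half_tape_update_of_neg (by omega) T d hneg)

theorem HStep.exists_zstep_sync {r : ℤ} {z : ZConf P Γ} {a c : Half P Γ}
    {p : P} (h : HStep R (-1) (some p) (z.half (-1) r) a)
    (h' : HStep R 1 (some p) (z.half 1 (r + 1)) c) :
    ∃ z' D, ZStep R D z z' ∧ z'.half (-1) r = a ∧ z'.half 1 (r + 1) = c := by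
  by_cases hin : 0 ≤ -1 * (z.pos - r)
  · have := h.exists_zstep_exit (c := c) (Or.inr rfl) (by simpa using h') hin
    simpa using this
  · obtain ⟨z', D, h1, h2, h3⟩ := h'.exists_zstep_exit (c := a) (Or.inl rfl) (by simpa using h)
      (by omega)
    exact ⟨z', D, h1, by simpa using h3, h2⟩

/-- Runs on the two halves of a tape with the same labels come from a run of the machine. -/
theorem exists_zrun_of_half_runs {r : ℤ} {s : List P} {z : ZConf P Γ} {a c : Half P Γ}
    (h : HRun R (-1) s (z.half (-1) r) a) (h' : HRun R 1 s (z.half 1 (r + 1)) c) :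
    ∃ z', ZRun R z z' ∧ z'.half (-1) r = a ∧ z'.half 1 (r + 1) = c := by
  generalize hx : z.half (-1) r = x at h
  -- Inner steps of the left run are performed first. When that run ends or reaches a crossing, the
  -- right run catches up by its own inner steps, and then a crossing is made by both at once.
  induction h generalizing z with
  | refl =>
    subst hx
    generalize hy : z.half 1 (r + 1) = y at h'
    generalize hs : ([] : List P) = s at h'
    induction h' generalizing z with
    | refl => exact ⟨z, .refl, rfl, hy⟩
    | inner h _ ih =>
      rw [← hy] at h
      obtain ⟨z₁, D, h1, h2, h3⟩ := h.exists_zstep_inner (Or.inl rfl)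
      obtain ⟨z', h4, h5, h6⟩ := ih h2 hs
      exact ⟨z', .head ⟨D, h1⟩ h4, by simpa [h3] using h5.trans (by simpa using h3), h6⟩
    | sync => simp at hs
  | inner h _ ih =>
    rw [← hx] at h
    obtain ⟨z₁, D, h1, h2, h3⟩ := h.exists_zstep_inner (Or.inr rfl)
    have h3' : z₁.half 1 (r + 1) = z.half 1 (r + 1) := by simpa using h3
    obtain ⟨z', h4, h5, h6⟩ := ih (by rwa [h3']) h2
    exact ⟨z', .head ⟨D, h1⟩ h4, h5, h6⟩
  | @sync a₁ b₁ c₁ p s h hr ih =>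
    generalize hy : z.half 1 (r + 1) = y at h'
    generalize hs : p :: s = t at h'
    induction h' generalizing z with
    | refl => simp at hs
    | inner h'' _ ih' =>
      rw [← hy] at h''
      obtain ⟨z₁, D, h1, h2, h3⟩ := h''.exists_zstep_inner (Or.inl rfl)
      obtain ⟨z', h4, h5, h6⟩ := ih' ih ((by simpa using h3 : z₁.half (-1) r = _).trans hx) h2 hs
      exact ⟨z', .head ⟨D, h1⟩ h4, h5, h6⟩
    | sync h'' hr' ih' =>
      obtain ⟨rfl, rfl⟩ := List.cons.inj hs
      rw [← hy] at h''
      rw [← hx] at h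
      obtain ⟨z₁, D, h1, h2, h3⟩ := h.exists_zstep_sync h''
      obtain ⟨z', h4, h5, h6⟩ := ih (by rwa [h3]) h2
      exact ⟨z', .head ⟨D, h1⟩ h4, h5, h6⟩

theorem ZConf.eq_of_halves_eq {r : ℤ} {z z' : ZConf P Γ} (h : z.half (-1) r = z'.half (-1) r)
    (h' : z.half 1 (r + 1) = z'.half 1 (r + 1)) : z = z' := by
  obtain ⟨p, T, i⟩ := z
  obtain ⟨p', T', i'⟩ := z'
  obtain rfl : T = T' := by
    funext j
    rcases le_or_gt j r with hj | hj
    · have := congrFun (congrArg Half.tape h) (r - j).toNat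
      simp only [ZConf.half] at this
      rwa [show r + -1 * ((r - j).toNat : ℤ) = j by omega] at this
    · have := congrFun (congrArg Half.tape h') (j - (r + 1)).toNat
      simp only [ZConf.half] at this
      rwa [show r + 1 + 1 * ((j - (r + 1)).toNat : ℤ) = j by omega] at this
  have h1 := congrArg Half.act h
  have h2 := congrArg Half.act h'
  simp only [ZConf.half] at h1 h2
  split_ifs at h1 h2 <;>
    simp only [Option.some.injEq, Prod.mk.injEq] at h1 h2 <;>
    first
      | omega
      | (obtain ⟨rfl, h1⟩ := h1; simp; omega)
      | (obtain ⟨rfl, h2⟩ := h2; simp; omega)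

end HalfTapes

/-! ### Finite tape contents on a two-way infinite tape -/

section WordTapes

variable {Γ : Type*} {z₀ : Γ}

/-- The two-way infinite tape that contains the word `w` from cell `b` on and is blank elsewhere. -/
def wordTape (z₀ : Γ) (b : ℤ) (w : List Γ) (j : ℤ) : Γ :=
  if b ≤ j then w.getD (j - b).toNat z₀ else z₀

theorem wordTape_append_right {b : ℤ} (l r : List Γ) (n : ℕ) :
    wordTape z₀ b (l ++ r) (b + l.length + n) = r.getD n z₀ := by
  rw [wordTape, if_pos (by omega), show (b + l.length + n - b).toNat = l.length + n by omega,
    List.getD_append_right _ _ _ _ (by omega)]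
  simp

theorem wordTape_append_left {b : ℤ} (l r : List Γ) (n : ℕ) :
    wordTape z₀ b (l ++ r) (b + l.length - 1 - n) = l.reverse.getD n z₀ := by
  unfold wordTape
  split_ifs with h
  · rw [List.getD_append _ _ _ _ (by omega), List.getD_eq_getElem _ _ (by omega),
      List.getD_eq_getElem _ _ (by simp; omega), List.getElem_reverse]
    congr 1
    omega
  · rw [List.getD_eq_default _ _ (by simp; omega)]

theorem wordTape_at (b : ℤ) (x : List Γ) (c : Γ) (y : List Γ) :
    wordTape z₀ b (x ++ c :: y) (b + x.length) = c := by
  simpa using wordTape_append_right (z₀ := z₀) (b := b) x (c :: y) 0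

theorem wordTape_update (b : ℤ) (x : List Γ) (c d : Γ) (y : List Γ) :
    Function.update (wordTape z₀ b (x ++ c :: y)) (b + x.length) d =
      wordTape z₀ b (x ++ d :: y) := by
  funext j
  rcases eq_or_ne j (b + x.length) with rfl | hj
  · rw [Function.update_self, wordTape_at]
  · rw [Function.update_of_ne hj]
    unfold wordTape
    split_ifs with h
    · simp only [List.getD_eq_getElem?_getD, List.getElem?_append]
      split_ifs with h1
      · rfl
      · obtain ⟨n, hn⟩ : ∃ n, (j - b).toNat - x.length = n + 1 :=
          ⟨(j - b).toNat - x.length - 1, by omega⟩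
        simp [hn]
    · rfl

theorem wordTape_cons_blank (b : ℤ) (w : List Γ) :
    wordTape z₀ b (z₀ :: w) = wordTape z₀ (b + 1) w := by
  funext j
  unfold wordTape
  rcases lt_trichotomy j b with h | rfl | h
  · rw [if_neg (by omega), if_neg (by omega)]
  · simp
  · rw [if_pos (by omega), if_pos (by omega),
      show (j - b).toNat = (j - (b + 1)).toNat + 1 by omega, List.getD_cons_succ]

theorem wordTape_append_blank (b : ℤ) (w : List Γ) :
    wordTape z₀ b (w ++ [z₀]) = wordTape z₀ b w := by
  funext j
  unfold wordTape
  split_ifs with h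
  · simp only [List.getD_eq_getElem?_getD, List.getElem?_append]
    split_ifs with h1
    · rfl
    · rw [List.getElem?_eq_none (l := w) (by omega)]
      rcases Nat.eq_zero_or_pos ((j - b).toNat - w.length) with h2 | h2
      · simp [h2]
      · rw [List.getElem?_eq_none (by simp; omega)]
  · rfl

theorem wordTape_nil (b : ℤ) : wordTape z₀ b [] = fun _ => z₀ := by
  funext j
  simp [wordTape]

/-- The worktape contents `x`, `y` left and right of the head marker have no blanks at their
outer ends, except possibly in the scanned cell. -/
def Trimmed (z₀ : Γ) (x y : List Γ) : Prop :=
  x ≠ [] ∧ x.dropLast.head? ≠ some z₀ ∧ y.getLast? ≠ some z₀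

/-- The worktape contents `x`, `y` left and right of the head marker represent the two-way
infinite tape `T` with the head at cell `i`. -/
def Represents (z₀ : Γ) (x y : List Γ) (T : ℤ → Γ) (i : ℤ) : Prop :=
  Trimmed z₀ x y ∧ ∃ b, T = wordTape z₀ b (x ++ y) ∧ i = b + x.length - 1

/-- The base cell of the word is forced by the head position, which removes the existential. -/
theorem represents_concat {x : List Γ} {c : Γ} {y : List Γ} {T : ℤ → Γ} {i : ℤ} :
    Represents z₀ (x ++ [c]) y T i ↔ x.head? ≠ some z₀ ∧ y.getLast? ≠ some z₀ ∧
      T = wordTape z₀ (i - x.length) (x ++ c :: y) := by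
  constructor
  · rintro ⟨⟨-, h1, h2⟩, b, rfl, rfl⟩
    refine ⟨by simpa using h1, h2, ?_⟩
    simp only [List.length_append, List.length_singleton, List.append_assoc, List.singleton_append]
    congr 1
    push_cast
    ring
  · rintro ⟨h1, h2, rfl⟩
    exact ⟨⟨by simp, by simpa using h1, h2⟩, i - x.length, by simp, by simp; ring⟩

theorem Represents.scanned {x : List Γ} {c : Γ} {y : List Γ} {T : ℤ → Γ} {i : ℤ}
    (h : Represents z₀ (x ++ [c]) y T i) : T i = c := by
  obtain ⟨-, -, rfl⟩ := represents_concat.1 h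
  simpa using wordTape_at (z₀ := z₀) (i - x.length) x c y

theorem Represents.write {x : List Γ} {c : Γ} {y : List Γ} {T : ℤ → Γ} {i : ℤ}
    (h : Represents z₀ (x ++ [c]) y T i) (d : Γ) :
    Represents z₀ (x ++ [d]) y (Function.update T i d) i := by
  obtain ⟨h1, h2, rfl⟩ := represents_concat.1 h
  refine represents_concat.2 ⟨h1, h2, ?_⟩
  simpa using wordTape_update (z₀ := z₀) (i - x.length) x c d y

theorem List.eq_of_getD_eq {l l' : List Γ} (hl : l.getLast? ≠ some z₀)
    (hl' : l'.getLast? ≠ some z₀) (h : ∀ n, l.getD n z₀ = l'.getD n z₀) : l = l' := by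
  have key {a b : List Γ} (hb : b.getLast? ≠ some z₀) (h : ∀ n, a.getD n z₀ = b.getD n z₀) :
      b.length ≤ a.length := by
    by_contra! hlt
    apply hb
    have := h (b.length - 1)
    rw [List.getD_eq_default _ _ (by omega), List.getD_eq_getElem _ _ (by omega)] at this
    rw [List.getLast?_eq_getElem?, List.getElem?_eq_getElem (by omega), this]
  refine List.ext_getElem (le_antisymm (key hl fun n => (h n).symm) (key hl' h))
    fun n h1 h2 => ?_
  simpa [List.getD_eq_getElem?_getD, h1, h2] using h n

/-- Reading outwards from the scanned cell, each side is a list without a blank at its far end, so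
it is determined by its blank-padded values. -/
theorem Represents.unique {x y x' y' : List Γ} {T : ℤ → Γ} {i : ℤ}
    (h : Represents z₀ x y T i) (h' : Represents z₀ x' y' T i) : x = x' ∧ y = y' := by
  obtain rfl | ⟨x, c, rfl⟩ := x.eq_nil_or_concat'
  · exact absurd rfl h.1.1
  obtain rfl | ⟨x', c', rfl⟩ := x'.eq_nil_or_concat'
  · exact absurd rfl h'.1.1
  obtain rfl : c = c' := h.scanned.symm.trans h'.scanned
  obtain ⟨h1, h2, h3⟩ := represents_concat.1 h
  obtain ⟨h1', h2', h3'⟩ := represents_concat.1 h'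
  have e1 : x.reverse = x'.reverse := by
    refine List.eq_of_getD_eq (by simpa using h1) (by simpa using h1') fun n => ?_
    rw [← wordTape_append_left (b := i - x.length) x (c :: y), ← h3,
      ← wordTape_append_left (b := i - x'.length) x' (c :: y'), ← h3']
    congr 1
    ring
  obtain rfl := List.reverse_injective e1
  refine ⟨rfl, List.eq_of_getD_eq h2 h2' fun n => ?_⟩
  have := congrFun (h3.symm.trans h3') (i - x.length + x.length + (n + 1 : ℕ))
  rw [wordTape_append_right, wordTape_append_right] at this
  simpa using this

end WordTapes

/-! ### Eliminating the input -/

namespace NTM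

variable {Q A Γ : Type*} {M : NTM Q A Γ}

section Tapes

variable {x y : List Γ} {c : Γ} {T : ℤ → Γ} {i : ℤ}

theorem wordTape_leave_right (b : ℤ) (x : List Γ) (d : Γ) (y : List Γ) :
    wordTape M.blank b (x ++ (M.leave d y ++ y)) = wordTape M.blank b (x ++ d :: y) := by
  unfold leave
  split_ifs with h
  · obtain ⟨rfl, rfl⟩ := h
    simpa using (wordTape_append_blank b x).symm
  · rfl

/-- Discarding a blank at the left end moves the base one cell to the right; the length term
accounts for this. -/
theorem wordTape_leave_left (b : ℤ) (x : List Γ) (d : Γ) (y : List Γ) :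
    wordTape M.blank (b + x.length + 1 - (x ++ M.leave d x).length) (x ++ M.leave d x ++ y) =
      wordTape M.blank b (x ++ d :: y) := by
  unfold leave
  split_ifs with h
  · obtain ⟨rfl, rfl⟩ := h
    simpa using (wordTape_cons_blank b y).symm
  · simp only [List.length_append, List.length_singleton, List.append_assoc, List.singleton_append]
    congr 1
    push_cast
    ring

theorem getLast?_leave_ne (d : Γ) (h : y.getLast? ≠ some M.blank) :
    (M.leave d y ++ y).getLast? ≠ some M.blank := by
  unfold leave
  split_ifs with h1
  · simpa using h
  · rcases eq_or_ne y [] with rfl | hy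
    · simpa using h1
    · rwa [List.getLast?_append_of_ne_nil _ hy]

theorem head?_leave_ne (d : Γ) (h : x.head? ≠ some M.blank) :
    (x ++ M.leave d x).head? ≠ some M.blank := by
  unfold leave
  split_ifs with h1
  · simpa using h
  · cases x with
    | nil => simpa using h1
    | cons a x => simpa using h

theorem represents_leftEnd (h : Represents M.blank [c] y T i) (d : Γ) :
    Represents M.blank [M.blank] (M.leave d y ++ y) (Function.update T i d) (i - 1) := by
  obtain ⟨h1, h2, h3⟩ := (represents_concat (x := [])).1 (h.write (x := []) d)
  refine (represents_concat (x := [])).2 ⟨h1, getLast?_leave_ne d h2, ?_⟩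
  rw [h3]
  have := wordTape_leave_right (M := M) i [] d y
  simp only [List.nil_append, List.length_nil, Nat.cast_zero, sub_zero] at this ⊢
  rw [← this, wordTape_cons_blank, sub_add_cancel]

theorem represents_left (h : Represents M.blank (x ++ [c]) y T i) (hx : x ≠ []) (d : Γ) :
    Represents M.blank x (M.leave d y ++ y) (Function.update T i d) (i - 1) := by
  obtain ⟨h1, h2, h3⟩ := represents_concat.1 (h.write d)
  refine ⟨⟨hx, fun h4 => h1 ?_, getLast?_leave_ne d h2⟩, i - x.length, ?_, by ring⟩
  · rw [List.head?_eq_some_iff] at h4 ⊢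
    obtain ⟨l, hl⟩ := h4
    refine ⟨l ++ [x.getLast hx], ?_⟩
    rw [← List.cons_append, ← hl, List.dropLast_append_getLast]
  · rw [h3, wordTape_leave_right]

theorem represents_right {c' : Γ} (h : Represents M.blank (x ++ [c]) (c' :: y) T i) (d : Γ) :
    Represents M.blank (x ++ M.leave d x ++ [c']) y (Function.update T i d) (i + 1) := by
  obtain ⟨h1, h2, h3⟩ := represents_concat.1 (h.write d)
  refine represents_concat.2 ⟨head?_leave_ne d h1, fun h4 => h2 ?_, ?_⟩
  · rw [List.getLast?_cons, h4]
    rfl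
  · rw [h3, ← wordTape_leave_left]
    congr 1
    ring

theorem represents_rightEnd (h : Represents M.blank (x ++ [c]) [] T i) (d : Γ) :
    Represents M.blank (x ++ M.leave d x ++ [M.blank]) [] (Function.update T i d) (i + 1) := by
  obtain ⟨h1, h2, h3⟩ := represents_concat.1 (h.write d)
  refine represents_concat.2 ⟨head?_leave_ne d h1, by simp, ?_⟩
  rw [h3, ← wordTape_append_blank, List.append_assoc, List.singleton_append, ← wordTape_leave_left]
  congr 1
  ring

end Tapes

/-- The transition relation without input, on states with a flag that tells whether the
end-marker is still to be read. -/
inductive Act (M : NTM Q A Γ) : Q × Bool → Γ → Q × Bool → Γ → Dir → Prop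
  | silent {q q' : Q} {c d : Γ} {D : Dir} (h : (q, none, c, q', d, D) ∈ M.δ) (f : Bool) :
      Act M (q, f) c (q', f) d D
  | letter {q q' : Q} {a : A} {c d : Γ} {D : Dir}
      (h : (q, some (InputSym.letter a), c, q', d, D) ∈ M.δ) :
      Act M (q, true) c (q', true) d D
  | endmark {q q' : Q} {c d : Γ} {D : Dir}
      (h : (q, some InputSym.endmark, c, q', d, D) ∈ M.δ) :
      Act M (q, true) c (q', false) d D

/-- The possible remaining inputs before and after reading the end-marker. -/
inductive ValidInput : Bool → List (InputSym A) → Prop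
  | unread (w : List A) : ValidInput true (w.map InputSym.letter ++ [InputSym.endmark])
  | read : ValidInput false []

theorem exists_act {q q' : Q} {a : Option (InputSym A)} {c d : Γ} {D : Dir}
    (h : (q, a, c, q', d, D) ∈ M.δ) {f : Bool} {w : List (InputSym A)}
    (hw : ValidInput f (a.toList ++ w)) : ∃ f', ValidInput f' w ∧ M.Act (q, f) c (q', f') d D := by
  match a, h, hw with
  | none, h, hw => exact ⟨f, hw, .silent h f⟩
  | some a, h, hw =>
    generalize hu : (some a).toList ++ w = u at hw
    cases hw with
    | read => simp at hu
    | unread v =>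
      cases v with
      | nil =>
        simp only [Option.toList_some, List.singleton_append, List.map_nil, List.nil_append,
          List.cons.injEq] at hu
        obtain ⟨rfl, rfl⟩ := hu
        exact ⟨false, .read, .endmark h⟩
      | cons b v =>
        simp only [Option.toList_some, List.map_cons, List.cons_append,
          List.cons.injEq] at hu
        obtain ⟨rfl, rfl⟩ := hu
        exact ⟨true, .unread v, .letter h⟩

theorem Act.exists_mem {p p' : Q × Bool} {c d : Γ} {D : Dir} (h : M.Act p c p' d D) :
    ∃ a : Option (InputSym A), (p.1, a, c, p'.1, d, D) ∈ M.δ ∧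
      ∀ w, ValidInput p'.2 w → ValidInput p.2 (a.toList ++ w) := by
  cases h with
  | silent h f => exact ⟨_, h, fun w hw => hw⟩
  | letter h =>
    refine ⟨_, h, fun w hw => ?_⟩
    cases hw with
    | unread v => exact .unread (_ :: v)
  | endmark h =>
    refine ⟨_, h, fun w hw => ?_⟩
    cases hw
    exact .unread []

/-- The configuration `c` of the machine corresponds to the configuration `z` without input. -/
structure Simulates (M : NTM Q A Γ) (z : ZConf (Q × Bool) Γ) (c : Config Q A Γ) : Prop where
  state : z.ctl.1 = c.state
  input : ValidInput z.ctl.2 c.input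
  tape : Represents M.blank c.left c.right z.tape z.pos

theorem Step.exists_zstep {D : Dir} {c c' : Config Q A Γ} (h : M.Step D c c')
    {z : ZConf (Q × Bool) Γ} (hz : M.Simulates z c) :
    ∃ z', ZStep M.Act D z z' ∧ M.Simulates z' c' := by
  obtain ⟨⟨q₀, f⟩, T, i⟩ := z
  obtain ⟨rfl, hi, ht⟩ := hz
  dsimp only at hi ht
  cases h with
  | stay h w x y =>
    obtain rfl := ht.scanned
    obtain ⟨f', hf, ha⟩ := exists_act h hi
    exact ⟨_, .mk ha, rfl, hf, by simpa [Dir.shift] using ht.write _⟩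
  | leftEnd h w y =>
    obtain rfl := ht.scanned (x := [])
    obtain ⟨f', hf, ha⟩ := exists_act h hi
    exact ⟨_, .mk ha, rfl, hf, represents_leftEnd ht _⟩
  | left h w x y hx =>
    obtain rfl := ht.scanned
    obtain ⟨f', hf, ha⟩ := exists_act h hi
    exact ⟨_, .mk ha, rfl, hf, represents_left ht hx _⟩
  | rightEnd h w x =>
    obtain rfl := ht.scanned
    obtain ⟨f', hf, ha⟩ := exists_act h hi
    exact ⟨_, .mk ha, rfl, hf, represents_rightEnd ht _⟩
  | right h w x c' y' =>
    obtain rfl := ht.scanned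
    obtain ⟨f', hf, ha⟩ := exists_act h hi
    exact ⟨_, .mk ha, rfl, hf, represents_right ht _⟩

/-- The new tape contents are fixed before the input is quantified, and the input goes from after
the step to before it. A run can therefore be given its input backwards, starting from what remains
at the end. -/
theorem exists_step_of_zstep {D : Dir} {z z' : ZConf (Q × Bool) Γ} (h : ZStep M.Act D z z')
    {x y : List Γ} (hz : Represents M.blank x y z.tape z.pos) :
    ∃ x' y', Represents M.blank x' y' z'.tape z'.pos ∧ ∀ w', ValidInput z'.ctl.2 w' →
      ∃ w, ValidInput z.ctl.2 w ∧ M.Step D ⟨z.ctl.1, w, x, y⟩ ⟨z'.ctl.1, w', x', y'⟩ := by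
  obtain @⟨p, p', T, i, d, D, h⟩ := h
  obtain ⟨a, ha, hw⟩ := h.exists_mem
  dsimp only at hz ⊢
  obtain rfl | ⟨x, c, rfl⟩ := x.eq_nil_or_concat'
  · exact absurd rfl hz.1.1
  rw [hz.scanned] at ha
  cases D with
  | S =>
    exact ⟨_, _, by simpa [Dir.shift] using hz.write d, fun w' h' => ⟨_, hw w' h', .stay ha _ _ _⟩⟩
  | L =>
    rcases eq_or_ne x [] with rfl | hx
    · exact ⟨_, _, represents_leftEnd hz d, fun w' h' => ⟨_, hw w' h', .leftEnd ha _ _⟩⟩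
    · exact ⟨_, _, represents_left hz hx d, fun w' h' => ⟨_, hw w' h', .left ha _ _ _ hx⟩⟩
  | R =>
    cases y with
    | nil => exact ⟨_, _, represents_rightEnd hz d, fun w' h' => ⟨_, hw w' h', .rightEnd ha _ _⟩⟩
    | cons c' y =>
      exact ⟨_, _, represents_right hz d, fun w' h' => ⟨_, hw w' h', .right ha _ _ _ _⟩⟩

theorem exists_derives_of_zrun {z z' : ZConf (Q × Bool) Γ} (h : ZRun M.Act z z')
    {x y : List Γ} (hz : Represents M.blank x y z.tape z.pos) :
    ∃ x' y', Represents M.blank x' y' z'.tape z'.pos ∧ ∀ w', ValidInput z'.ctl.2 w' →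
      ∃ w, ValidInput z.ctl.2 w ∧ M.Derives ⟨z.ctl.1, w, x, y⟩ ⟨z'.ctl.1, w', x', y'⟩ := by
  induction h with
  | refl => exact ⟨x, y, hz, fun w' h' => ⟨w', h', .refl⟩⟩
  | tail _ hs ih =>
    obtain ⟨D, hs⟩ := hs
    obtain ⟨x₁, y₁, h1, h2⟩ := ih
    obtain ⟨x₂, y₂, h3, h4⟩ := exists_step_of_zstep hs h1
    refine ⟨x₂, y₂, h3, fun w' h' => ?_⟩
    obtain ⟨w₁, h5, h6⟩ := h4 w' h'
    obtain ⟨w, h7, h8⟩ := h2 w₁ h5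
    exact ⟨w, h7, h8.tail ⟨D, h6⟩⟩

end NTM

/-! ### Accepting computations seen from one half -/

section HalfAcceptance

variable {P Γ : Type*} {R : P → Γ → P → Γ → Dir → Prop} {p₀ : P} {z₀ : Γ} {Fin : P → Prop}

/-- The half-tape configuration `a` can be reached from a blank half tape, holding the head if
`i` is true, by a run with labels `s`, and a run with labels `t` leads from `a` to a
configuration that accepts if it holds the head. -/
def HalfAccepts (R : P → Γ → P → Γ → Dir → Prop) (p₀ : P) (z₀ : Γ) (Fin : P → Prop) (e : ℤ)
    (i : Bool) (s t : List P) (a : Half P Γ) : Prop :=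
  ∃ a₀ a', a₀.tape = (fun _ => z₀) ∧ (if i then ∃ n, a₀.act = some (p₀, n) else a₀.act = none) ∧
    HRun R e s a₀ a ∧ HRun R e t a a' ∧ ∀ p n, a'.act = some (p, n) → Fin p

theorem ZConf.eq_ctl_of_half_act {e b : ℤ} {z : ZConf P Γ} {p : P} {n : ℕ}
    (h : (z.half e b).act = some (p, n)) : p = z.ctl := by
  simp only [ZConf.half] at h
  split_ifs at h
  simp only [Option.some.injEq, Prod.mk.injEq] at h
  exact h.1.symm

theorem exists_blank_zconf (r : ℤ) {i : Bool} {a c : Half P Γ} (ha : a.tape = fun _ => z₀)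
    (hai : if i then ∃ n, a.act = some (p₀, n) else a.act = none) (hc : c.tape = fun _ => z₀)
    (hci : if !i then ∃ n, c.act = some (p₀, n) else c.act = none) :
    ∃ i₀, (⟨p₀, fun _ => z₀, i₀⟩ : ZConf P Γ).half (-1) r = a ∧
      (⟨p₀, fun _ => z₀, i₀⟩ : ZConf P Γ).half 1 (r + 1) = c := by
  cases i with
  | true =>
    obtain ⟨n, hn⟩ : ∃ n, a.act = some (p₀, n) := by simpa using hai
    have hci' : c.act = none := by simpa using hci
    refine ⟨r - n, Half.ext ?_ ha.symm, Half.ext ?_ hc.symm⟩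
    · rw [hn]
      exact ZConf.half_act_of_nonneg (by dsimp only; ring)
    · rw [hci']
      exact ZConf.half_act_of_neg (by dsimp only; omega)
  | false =>
    obtain ⟨n, hn⟩ : ∃ n, c.act = some (p₀, n) := by simpa using hci
    have hai' : a.act = none := by simpa using hai
    refine ⟨r + 1 + n, Half.ext ?_ ha.symm, Half.ext ?_ hc.symm⟩
    · rw [hai']
      exact ZConf.half_act_of_neg (by dsimp only; omega)
    · rw [hn]
      exact ZConf.half_act_of_nonneg (by dsimp only; ring)

/-- The half runs are glued twice, up to `z` and from `z` on. The starting cell `i₀` is whatever the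
half that holds the head dictates. -/
theorem exists_zruns_of_halfAccepts {z : ZConf P Γ} {r : ℤ} {i : Bool} {s t : List P}
    (h : HalfAccepts R p₀ z₀ Fin (-1) i s t (z.half (-1) r))
    (h' : HalfAccepts R p₀ z₀ Fin 1 (!i) s t (z.half 1 (r + 1))) :
    ∃ i₀ z', ZRun R ⟨p₀, fun _ => z₀, i₀⟩ z ∧ ZRun R z z' ∧ Fin z'.ctl := by
  obtain ⟨a₀, a', ha, hai, ha1, ha2, ha3⟩ := h
  obtain ⟨c₀, c', hc, hci, hc1, hc2, hc3⟩ := h'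
  obtain ⟨i₀, rfl, rfl⟩ := exists_blank_zconf r ha hai hc hci
  obtain ⟨z₁, h1, h2, h3⟩ := exists_zrun_of_half_runs ha1 hc1
  obtain rfl := ZConf.eq_of_halves_eq h2 h3
  obtain ⟨z', h4, rfl, rfl⟩ := exists_zrun_of_half_runs ha2 hc2
  refine ⟨i₀, z', h1, h4, ?_⟩
  -- Exactly one half holds the head at the end, and its acceptance condition applies.
  by_cases hin : 0 ≤ -1 * (z'.pos - r)
  · exact ha3 _ _ (if_pos hin)
  · exact hc3 z'.ctl _ (if_pos (by omega))

open Classical in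
theorem exists_halfAccepts {z : ℕ → ZConf P Γ} {dir : ℕ → Dir} {n t k : ℕ} {i₀ : ℤ}
    (hz : ∀ j < n, ZStep R (dir j) (z j) (z (j + 1))) (h0 : z 0 = ⟨p₀, fun _ => z₀, i₀⟩)
    (hn : Fin (z n).ctl) (ht : t ≤ n) (r : ℤ)
    (hk : Nat.count (fun j => ((z j).pos = r ∧ (z (j + 1)).pos = r + 1) ∨
        ((z j).pos = r + 1 ∧ (z (j + 1)).pos = r)) n ≤ k) :
    ∃ (i : Bool) (s₁ s₂ : {s : List P // s.length ≤ k}),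
      HalfAccepts R p₀ z₀ Fin (-1) i s₁ s₂ ((z t).half (-1) r) ∧
      HalfAccepts R p₀ z₀ Fin 1 (!i) s₁ s₂ ((z t).half 1 (r + 1)) := by
  obtain ⟨s₁, h1, h2, h3⟩ := exists_half_runs hz r (Nat.zero_le t) ht
  obtain ⟨s₂, h4, h5, h6⟩ := exists_half_runs hz r ht le_rfl
  refine ⟨decide (0 ≤ -1 * (i₀ - r)), ⟨s₁, h1.trans ((Nat.count_monotone _ ht).trans hk)⟩,
    ⟨s₂, h4.trans hk⟩, ⟨_, _, ?_, ?_, h2, h5, ?_⟩, ⟨_, _, ?_, ?_, h3, h6, ?_⟩⟩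
  · rw [h0]; rfl
  · by_cases h : 0 ≤ -1 * (i₀ - r)
    · simpa only [h, decide_true, if_true, h0] using ⟨_, if_pos h⟩
    · simpa only [h, decide_false, Bool.false_eq_true, if_false, h0] using
        ZConf.half_act_of_neg (not_le.1 h)
  · intro p m h
    rwa [ZConf.eq_ctl_of_half_act h]
  · rw [h0]; rfl
  · by_cases h : 0 ≤ -1 * (i₀ - r)
    · have h' : ¬ 0 ≤ 1 * (i₀ - (r + 1)) := by omega
      simpa only [h, decide_true, Bool.not_true, Bool.false_eq_true, if_false, h0] using
        ZConf.half_act_of_neg (not_le.1 h')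
    · have h' : 0 ≤ 1 * (i₀ - (r + 1)) := by omega
      simpa only [h, decide_false, Bool.not_false, if_true, h0] using ⟨_, if_pos h'⟩
  · intro p m h
    rwa [ZConf.eq_ctl_of_half_act h]

theorem half_left_wordTape {p : P} {b i : ℤ} (l r : List Γ) :
    ((⟨p, wordTape z₀ b (l ++ r), i⟩ : ZConf P Γ).half (-1) (b + l.length - 1)).tape =
      fun n => l.reverse.getD n z₀ := by
  funext n
  rw [← wordTape_append_left (b := b) l r]
  simp only [ZConf.half]
  congr 1
  ring

theorem half_right_wordTape {p : P} {b i : ℤ} (l r : List Γ) :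
    ((⟨p, wordTape z₀ b (l ++ r), i⟩ : ZConf P Γ).half 1 (b + l.length - 1 + 1)).tape =
      fun n => r.getD n z₀ := by
  funext n
  rw [← wordTape_append_right (b := b) l r]
  simp only [ZConf.half]
  congr 1
  ring

end HalfAcceptance

/-! ### Behaviour sets and regularity of the store language -/

namespace NTM

variable {Q A Γ : Type*} {M : NTM Q A Γ}

theorem Derives.exists_extension {n : ℕ} {cfg : ℕ → Config Q A Γ} {dir : ℕ → Dir}
    (hs : ∀ j < n, M.Step (dir j) (cfg j) (cfg (j + 1))) {c : Config Q A Γ}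
    (h : M.Derives (cfg n) c) :
    ∃ m ≥ n, ∃ (cfg' : ℕ → Config Q A Γ) (dir' : ℕ → Dir), (∀ j ≤ n, cfg' j = cfg j) ∧
      cfg' m = c ∧ ∀ j < m, M.Step (dir' j) (cfg' j) (cfg' (j + 1)) := by
  induction h with
  | refl => exact ⟨n, le_rfl, cfg, dir, fun _ _ => rfl, rfl, hs⟩
  | @tail b c _ h ih =>
    obtain ⟨D, h⟩ := h
    obtain ⟨m, hm, cfg', dir', h1, rfl, h2⟩ := ih
    refine ⟨m + 1, by omega, Function.update cfg' (m + 1) c, Function.update dir' m D,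
      fun j hj => ?_, Function.update_self .., fun j hj => ?_⟩
    · rw [Function.update_of_ne (by omega), h1 j hj]
    · rcases Nat.lt_succ_iff_lt_or_eq.1 hj with hj | rfl
      · rw [Function.update_of_ne (by omega), Function.update_of_ne (by omega),
          Function.update_of_ne (by omega)]
        exact h2 j hj
      · rwa [Function.update_self, Function.update_of_ne (by omega), Function.update_self]

theorem exists_acceptingComputation {w : List A} {c c' : Config Q A Γ}
    (h : M.Derives (M.init w) c) (h' : M.Derives c c') (hacc : M.IsAccepting c') :
    ∃ (C : M.AcceptingComputation) (t : ℕ), t ≤ C.len ∧ C.cfg t = c := by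
  obtain ⟨t, -, cfg, dir, h1, rfl, h2⟩ := Derives.exists_extension (n := 0)
    (cfg := fun _ => M.init w) (dir := fun _ => Dir.S) (by simp) h
  obtain ⟨m, hm, cfg', dir', h3, rfl, h4⟩ := Derives.exists_extension h2 h'
  exact ⟨⟨w, m, cfg', dir', by rw [h3 0 (Nat.zero_le _), h1 0 le_rfl], h4, hacc⟩, t, hm,
    h3 t le_rfl⟩

theorem represents_init (i : ℤ) : Represents M.blank [M.blank] [] (fun _ => M.blank) i := by
  refine (represents_concat (x := [])).2 ⟨by simp, by simp, ?_⟩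
  rw [wordTape_append_blank, wordTape_nil]

theorem AcceptingComputation.exists_zconfs (C : M.AcceptingComputation) :
    ∃ z : ℕ → ZConf (Q × Bool) Γ, z 0 = ⟨(M.start, true), fun _ => M.blank, 1⟩ ∧
      (∀ j ≤ C.len, M.Simulates (z j) (C.cfg j)) ∧
      (∀ j < C.len, ZStep M.Act (C.dir j) (z j) (z (j + 1))) ∧
      ∀ j ≤ C.len, (z j).pos = C.addr j := by
  suffices H : ∀ n ≤ C.len, ∃ z : ℕ → ZConf (Q × Bool) Γ,
      z 0 = ⟨(M.start, true), fun _ => M.blank, 1⟩ ∧ (∀ j ≤ n, M.Simulates (z j) (C.cfg j)) ∧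
      (∀ j < n, ZStep M.Act (C.dir j) (z j) (z (j + 1))) ∧ ∀ j ≤ n, (z j).pos = C.addr j from
    H C.len le_rfl
  intro n
  induction n with
  | zero =>
    refine fun _ => ⟨fun _ => ⟨(M.start, true), fun _ => M.blank, 1⟩, rfl, ?_, by simp, ?_⟩
    · intro j hj
      obtain rfl := Nat.le_zero.1 hj
      rw [C.cfg_zero]
      exact ⟨rfl, .unread _, represents_init 1⟩
    · intro j hj
      obtain rfl := Nat.le_zero.1 hj
      rfl
  | succ n ih =>
    intro hn
    obtain ⟨z, h0, h1, h2, h3⟩ := ih (by omega)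
    obtain ⟨z', h4, h5⟩ := (C.step n hn).exists_zstep (h1 n le_rfl)
    have hlt : ∀ j ≤ n, Function.update z (n + 1) z' j = z j :=
      fun j hj => Function.update_of_ne (by omega) _ _
    refine ⟨Function.update z (n + 1) z', by rw [hlt 0 (Nat.zero_le _), h0],
      fun j hj => ?_, fun j hj => ?_, fun j hj => ?_⟩
    · rcases Nat.le_succ_iff.1 hj with hj | rfl
      · rw [hlt j hj]
        exact h1 j hj
      · rwa [Function.update_self]
    · rcases Nat.lt_succ_iff_lt_or_eq.1 hj with hj | rfl
      · rw [hlt j hj.le, hlt (j + 1) hj]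
        exact h2 j hj
      · rwa [hlt j le_rfl, Function.update_self]
    · rcases Nat.le_succ_iff.1 hj with hj | rfl
      · rw [hlt j hj]
        exact h3 j hj
      · rw [Function.update_self]
        change _ = C.addr n + (C.dir n).shift
        rw [← h3 n le_rfl]
        generalize z n = x, C.dir n = D at h4
        cases h4
        rfl

/-- Possible behaviours at the boundary of a half tape: whether the head starts on it, and the
sequences of states on crossing the boundary, before and after the configuration considered. -/
abbrev Crossings (Q : Type*) (k : ℕ) : Type _ :=
  Bool × {s : List (Q × Bool) // s.length ≤ k} × {s : List (Q × Bool) // s.length ≤ k}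

instance [Finite Q] (k : ℕ) : Finite {s : List (Q × Bool) // s.length ≤ k} :=
  (List.finite_length_le (Q × Bool) k).to_subtype

/-- The behaviours with which a half-tape configuration occurs in accepting computations. -/
def crossings (M : NTM Q A Γ) (k : ℕ) (e : ℤ) (a : Half (Q × Bool) Γ) : Set (Crossings Q k) :=
  {σ | HalfAccepts M.Act (M.start, true) M.blank (fun p => p.1 ∈ M.final ∧ p.2 = false) e
    σ.1 σ.2.1 σ.2.2 a}

/-- Some accepting computation contains `z`, with a given bound on the number of crossings of
the boundary between cells `r` and `r + 1`. -/
def Matches (M : NTM Q A Γ) (k : ℕ) (r : ℤ) (z : ZConf (Q × Bool) Γ) : Prop :=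
  ∃ σ : Crossings Q k, σ ∈ M.crossings k (-1) (z.half (-1) r) ∧
    (!σ.1, σ.2) ∈ M.crossings k 1 (z.half 1 (r + 1))

theorem exists_matches_of_mem {k : ℕ} (hk : ∀ C : M.AcceptingComputation, C.IsCrossingBounded k)
    {q : Q} {x y : List Γ} (h : storeWord q x y ∈ M.storeLanguage) :
    ∃ f T i, Represents M.blank x y T i ∧ ∀ r, M.Matches k r ⟨(q, f), T, i⟩ := by
  classical
  obtain ⟨w, c, c', h1, h2, h3, h4⟩ := h
  obtain ⟨rfl, rfl, rfl⟩ := storeWord_injective (q' := c.state) (x' := c.left) (y' := c.right) h4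
  obtain ⟨C, t, ht, rfl⟩ := exists_acceptingComputation h1 h2 h3
  obtain ⟨z, hz0, hsim, hz, hpos⟩ := C.exists_zconfs
  have ht' := hsim t ht
  refine ⟨(z t).ctl.2, (z t).tape, (z t).pos, ht'.tape, fun r => ?_⟩
  -- An empty remaining input is possible only after the end-marker has been read.
  have hn : (z C.len).ctl.1 ∈ M.final ∧ (z C.len).ctl.2 = false := by
    have hl := hsim C.len le_rfl
    refine ⟨by rw [hl.state]; exact C.accepting.1, ?_⟩
    have := hl.input
    rw [C.accepting.2] at this
    generalize (z C.len).ctl.2 = f, hu : ([] : List (InputSym A)) = u at this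
    cases this with
    | unread w => simp at hu
    | read => rfl
  have hcount := hk C r
  have hset : {j : ℕ | j < C.len ∧ ((C.addr j = r ∧ C.addr (j + 1) = r + 1) ∨
      (C.addr j = r + 1 ∧ C.addr (j + 1) = r))} = {j : ℕ | j < C.len ∧
      (((z j).pos = r ∧ (z (j + 1)).pos = r + 1) ∨ ((z j).pos = r + 1 ∧ (z (j + 1)).pos = r))} := by
    ext j
    refine and_congr_right fun hj => ?_
    rw [hpos j hj.le, hpos (j + 1) hj]
  rw [hset, Nat.ncard_setOf_lt_and] at hcount
  obtain ⟨i, s₁, s₂, h5, h6⟩ := exists_halfAccepts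
    (Fin := fun p : Q × Bool => p.1 ∈ M.final ∧ p.2 = false) hz hz0 hn ht r hcount
  rw [← ht'.state]
  exact ⟨(i, s₁, s₂), h5, h6⟩

/-- One boundary suffices: gluing there already gives an accepting computation. It may start at any
cell, because the initial worktape represents the blank tape at every position. -/
theorem mem_of_matches {k : ℕ} {r i : ℤ} {q : Q} {f : Bool} {x y : List Γ} {T : ℤ → Γ}
    (hr : Represents M.blank x y T i) (h : M.Matches k r ⟨(q, f), T, i⟩) :
    storeWord q x y ∈ M.storeLanguage := by
  obtain ⟨σ, h1, h2⟩ := h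
  obtain ⟨i₀, z', h3, h4, h5, h6⟩ := exists_zruns_of_halfAccepts h1 h2
  obtain ⟨x₁, y₁, h7, h8⟩ := exists_derives_of_zrun h3 (represents_init i₀)
  obtain ⟨rfl, rfl⟩ := h7.unique hr
  obtain ⟨x₂, y₂, -, h9⟩ := exists_derives_of_zrun h4 hr
  obtain ⟨w, hw, hd⟩ := h9 [] (by rw [h6]; exact .read)
  obtain ⟨w₀, hw₀, hd₀⟩ := h8 w hw
  cases hw₀ with
  | unread u => exact ⟨u, _, _, hd₀, hd, ⟨h5, rfl⟩, rfl⟩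

/-- The store language is regular if in all accepting computations the number of crossings of a
boundary between adjacent cells is bounded. -/
theorem FiniteCrossing.isRegular_storeLanguage [Finite Q] [Finite Γ] (h : M.FiniteCrossing) :
    M.storeLanguage.IsRegular := by
  obtain ⟨k, hk⟩ := h
  refine isRegular_of_finite_index (G := fun q x y => storeWord q x y ∈ M.storeLanguage)
    (fun s => ⟨?_, ?_⟩)
    -- Besides the behaviour set, a class records the data needed to see that the new word is still
    -- trimmed: here the first symbol, below the last symbol of the right part and the condition on
    -- the left part.
    (fun x => (M.crossings k (-1) ⟨none, fun n => x.reverse.getD n M.blank⟩, x.head?))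
    -- The end-marker flag is not visible in the store word, so the behaviour set is recorded for
    -- both values. The head is `y.length` cells away from the cut.
    (fun q x y => (fun f : Bool => M.crossings k (-1)
      ⟨some ((q, f), y.length), fun n => (x ++ y).reverse.getD n M.blank⟩, y.getLast?,
      x ≠ [] ∧ x.dropLast.head? ≠ some M.blank)) ?_ ?_
  · rintro ⟨w, c, c', h1, h2, h3, rfl⟩
    exact ⟨c.state, c.left, c.right, rfl, w, c, c', h1, h2, h3, rfl⟩
  · rintro ⟨q, x, y, rfl, hG⟩
    exact hG
  · intro q x₁ x₂ hφ x y hx hmem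
    simp only [Prod.mk.injEq] at hφ
    obtain ⟨hφ, hhead⟩ := hφ
    obtain ⟨f, T, i, ⟨htrim, b, rfl, rfl⟩, hmatch⟩ := exists_matches_of_mem hk hmem
    obtain ⟨σ, h1, h2⟩ := hmatch (b + x₁.length - 1)
    have hlen := List.length_pos_iff.2 hx
    -- The base is chosen so that the replaced prefix ends at the same cell; the cut and the right
    -- half stay in place.
    set b' : ℤ := b + x₁.length - x₂.length with hb'
    have hb : b + x₁.length - 1 = b' + x₂.length - 1 := by omega
    refine mem_of_matches (k := k) (r := b' + x₂.length - 1) (f := f)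
      ⟨?_, b', rfl, rfl⟩ ⟨σ, ?_, ?_⟩
    · refine ⟨by simp [hx], ?_, htrim.2.2⟩
      have := htrim.2.1
      rw [List.dropLast_append_of_ne_nil hx, List.head?_append] at this ⊢
      rwa [← hhead]
    · convert h1 using 1
      convert hφ.symm using 2
      · refine Half.ext (ZConf.half_act_of_neg ?_) ?_
        · simp only [List.length_append]; omega
        · rw [List.append_assoc, half_left_wordTape]
      · refine Half.ext (ZConf.half_act_of_neg ?_) ?_
        · simp only [List.length_append]; omega
        · rw [List.append_assoc, half_left_wordTape]
    · convert h2 using 2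
      refine Half.ext ?_ ?_
      · simp only [ZConf.half, List.length_append, Nat.cast_add]
        rw [show b' + (x₂.length + x.length) - 1 - (b' + x₂.length - 1 + 1) =
          b + (x₁.length + x.length) - 1 - (b + x₁.length - 1 + 1) by ring]
      · rw [List.append_assoc, List.append_assoc, half_right_wordTape, half_right_wordTape]
  · intro q x₁ x₂ y₁ y₂ hψ y hmem
    simp only [Prod.mk.injEq] at hψ
    obtain ⟨hψ, hlast, htrim'⟩ := hψ
    obtain ⟨f, T, i, ⟨htrim, b, rfl, rfl⟩, hmatch⟩ := exists_matches_of_mem hk hmem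
    obtain ⟨σ, h1, h2⟩ := hmatch (b + (x₁ ++ y₁).length - 1)
    have hf := congrFun hψ f
    -- Again the cut stays fixed, but the head is now on the replaced left half, so its own cell may
    -- change.
    set b' : ℤ := b + (x₁ ++ y₁).length - (x₂ ++ y₂).length with hb'
    have hact (b : ℤ) (x y : List Γ) (T : ℤ → Γ) :
        ((⟨(q, f), T, b + x.length - 1⟩ : ZConf (Q × Bool) Γ).half (-1)
          (b + (x ++ y).length - 1)).act = some ((q, f), y.length) :=
      ZConf.half_act_of_nonneg (by simp only [List.length_append]; push_cast; ring)
    have hnone (b : ℤ) (x y : List Γ) (T : ℤ → Γ) :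
        ((⟨(q, f), T, b + x.length - 1⟩ : ZConf (Q × Bool) Γ).half 1
          (b + (x ++ y).length - 1 + 1)).act = none :=
      ZConf.half_act_of_neg (by simp only [List.length_append]; push_cast; omega)
    refine mem_of_matches (k := k) (r := b' + (x₂ ++ y₂).length - 1) (f := f)
      ⟨?_, b', rfl, rfl⟩ ⟨σ, ?_, ?_⟩
    · have h3 : x₂ ≠ [] ∧ x₂.dropLast.head? ≠ some M.blank := htrim' ▸ ⟨htrim.1, htrim.2.1⟩
      refine ⟨h3.1, h3.2, ?_⟩
      have := htrim.2.2
      rw [List.getLast?_append] at this ⊢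
      rwa [← hlast]
    · convert h1 using 1
      convert hf.symm using 2
      · exact Half.ext (hact ..) (by rw [← List.append_assoc, half_left_wordTape])
      · exact Half.ext (hact ..) (by rw [← List.append_assoc, half_left_wordTape])
    · convert h2 using 2
      refine Half.ext ((hnone ..).trans (hnone ..).symm) ?_
      rw [← List.append_assoc, ← List.append_assoc, half_right_wordTape, half_right_wordTape]

end NTM

theorem mainTheorem1 {Q A Γ : Type*} [Finite Q] [Finite A] [Finite Γ] (M : NTM Q A Γ) :
    (M.FiniteCrossing → M.storeLanguage.IsRegular) ∧
    (M.FiniteVisit → M.storeLanguage.IsRegular) ∧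
    (M.FiniteTurn → M.storeLanguage.IsRegular) :=
  ⟨fun h => h.isRegular_storeLanguage, fun h => h.finiteCrossing.isRegular_storeLanguage,
    fun h => h.finiteCrossing.isRegular_storeLanguage⟩
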